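/- Consider a DC power network on a connected simple graph $\mathcal G=(\mathcal V,\mathcal E)$ with $N_{\rm G}\ge 1$ generator buses $1,\dots,N_{\rm G}$ and $N_{\rm L}$ load buses $N_{\rm G}+1,\dots,N=N_{\rm G}+N_{\rm L}$ (no bus is both), and $E$ labelled, arbitrarily oriented branches with susceptances $b_e>0$. Let $\mathbf C\in\mathbb R^{N\times E}$ be the signed incidence matrix and $\mathbf B=\mathrm{diag}(b_1,\dots,b_E)$. Let $\underline{\mathbf s}^g<\overline{\mathbf s}^g$ be generation limits in $\mathbb R^{N_{\rm G}}$, let $\underline{\mathbf p}<\overline{\mathbf p}$ be branch flow limits in $\mathbb R^{E}$ (both strict in every entry), and let $\mathbf f\in\mathbb R^{N_{\rm G}}$ be a cost vector. For a load vector $\mathbf s^l\in\mathbb R^{N_{\rm L}}$ consider the linear program $$\min_{\mathbf s^g,\,\boldsymbol\theta}\ \mathbf f^{\mathsf T}\mathbf s^g\quad\text{s.t.}\quad \boldsymbol\theta_1=0,\quad \mathbf C\mathbf B\mathbf C^{\mathsf T}\boldsymbol\theta=\begin{bmatrix}\mathbf s^g\\-\mathbf s^l\end{bmatrix},\quad \underline{\mathbf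 s}^g\le\mathbf s^g\le\overline{\mathbf s}^g,\quad \underline{\mathbf p}\le\mathbf B\mathbf C^{\mathsf T}\boldsymbol\theta\le\overline{\mathbf p}.$$ Let $\Omega_{\mathbf s^l}$ be the set of entrywise positive $\mathbf s^l$ for which this program is feasible, and assume that for every $\mathbf s^l\in\Omega_{\mathbf s^l}$ the optimal generation vector exists and is unique; denote it by $\mathcal{OPF}(\mathbf s^l)\in\mathbb R^{N_{\rm G}}$. If $\mathcal G$ is a tree, then the network is monotone: for all $\boldsymbol\alpha,\boldsymbol\beta\in\Omega_{\mathbf s^l}$ such that $\boldsymbol\alpha\ge\boldsymbol\beta$ entrywise and $\boldsymbol\alpha-\boldsymbol\beta$ has exactly one nonzero entry, $\mathcal{OPF}(\boldsymbol\alpha)\ge\mathcal{OPF}(\boldsymbol\beta)$ entrywise. -/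

import Mathlib

/-- The buses of a network with `nG` generators and `nL` loads: generator buses first, then load
buses.  The disjoint sum encodes that no bus is both a generator and a load. -/
abbrev Bus (nG nL : ℕ) : Type := Fin nG ⊕ Fin nL

/-- A power system: a connected network with generators, loads and `nE` labelled branches of
positive susceptance, together with generation limits, branch flow limits and linear generation
costs.  `src` and `tgt` fix the (arbitrary) reference orientation of the branches. -/
structure PowerSystem (nG nL nE : ℕ) where
  /-- the underlying undirected graph -/
  graph : SimpleGraph (Bus nG nL)
  connected : graph.Connected
  /-- the labelling of the edges -/
  edge : Fin nE ≃ graph.edgeSet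
  src : Fin nE → Bus nG nL
  tgt : Fin nE → Bus nG nL
  edge_eq : ∀ e, (edge e : Sym2 (Bus nG nL)) = s(src e, tgt e)
  /-- branch susceptances -/
  b : Fin nE → ℝ
  b_pos : ∀ e, 0 < b e
  /-- lower and upper generation limits -/
  sgLo : Fin nG → ℝ
  sgHi : Fin nG → ℝ
  sg_lt : ∀ i, sgLo i < sgHi i
  /-- lower and upper branch flow limits -/
  pLo : Fin nE → ℝ
  pHi : Fin nE → ℝ
  p_lt : ∀ e, pLo e < pHi e
  /-- unit generation costs -/
  cost : Fin nG → ℝ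

namespace PowerSystem

variable {nG nL nE : ℕ}

/-- The signed incidence matrix `C`. -/
def incidence (P : PowerSystem nG nL nE) : Matrix (Bus nG nL) (Fin nE) ℝ :=
  Matrix.of fun i e => if i = P.src e then 1 else if i = P.tgt e then -1 else 0

/-- The branch flows `B Cᵀ θ` produced by the voltage angles `θ`. -/
def flow (P : PowerSystem nG nL nE) (θ : Bus nG nL → ℝ) : Fin nE → ℝ :=
  (Matrix.diagonal P.b * P.incidence.transpose).mulVec θ

/-- The constraints of the DC optimal power flow problem with loads `sl`, on the generations `sg`
and the voltage angles `θ`; the first generator bus is the slack bus. -/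
structure Feasible [NeZero nG] (P : PowerSystem nG nL nE) (sl : Fin nL → ℝ)
    (sg : Fin nG → ℝ) (θ : Bus nG nL → ℝ) : Prop where
  slack : θ (Sum.inl 0) = 0
  balance : (P.incidence * Matrix.diagonal P.b * P.incidence.transpose).mulVec θ
    = Sum.elim sg (-sl)
  gen_lower : ∀ i, P.sgLo i ≤ sg i
  gen_upper : ∀ i, sg i ≤ P.sgHi i
  flow_lower : ∀ e, P.pLo e ≤ P.flow θ e
  flow_upper : ∀ e, P.flow θ e ≤ P.pHi e

/-- The set of positive load vectors for which the DC optimal power flow problem is feasible. -/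
def loadRegion [NeZero nG] (P : PowerSystem nG nL nE) : Set (Fin nL → ℝ) :=
  {sl | (∀ i, 0 < sl i) ∧ ∃ sg θ, P.Feasible sl sg θ}

/-- `(sg, θ)` is an optimal solution: it is feasible and minimizes the total generation cost. -/
def IsOptimal [NeZero nG] (P : PowerSystem nG nL nE) (sl : Fin nL → ℝ)
    (sg : Fin nG → ℝ) (θ : Bus nG nL → ℝ) : Prop :=
  P.Feasible sl sg θ ∧ ∀ sg' θ', P.Feasible sl sg' θ' → P.cost ⬝ᵥ sg ≤ P.cost ⬝ᵥ sg'

/-- The set-valued optimal power flow operator: the set of optimal generation vectors. -/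
def opfSet [NeZero nG] (P : PowerSystem nG nL nE) (sl : Fin nL → ℝ) : Set (Fin nG → ℝ) :=
  {sg | ∃ θ, P.IsOptimal sl sg θ}

/-- The optimal generation vector is unique for every load vector in the load region. -/
def HasUniqueOptimum [NeZero nG] (P : PowerSystem nG nL nE) : Prop :=
  ∀ sl ∈ P.loadRegion, ∃! sg, sg ∈ P.opfSet sl

/-- The optimal power flow operator as a function on the load region. -/
noncomputable def opf [NeZero nG] (P : PowerSystem nG nL nE) (hP : P.HasUniqueOptimum)
    (sl : P.loadRegion) : Fin nG → ℝ :=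
  (hP sl.1 sl.2).choose

/-- Monotonicity: when exactly one load increases, no optimal generation decreases.
`hammingNorm` counts the nonzero entries of a vector. -/
def IsMonotone [NeZero nG] (P : PowerSystem nG nL nE) (hP : P.HasUniqueOptimum) : Prop :=
  ∀ α β : P.loadRegion, β.1 ≤ α.1 → hammingNorm (α.1 - β.1) = 1 → P.opf hP β ≤ P.opf hP α

end PowerSystem

namespace PowerSystem

variable {nG nL nE : ℕ}

/-! An exchange argument. Suppose generator `i` drops as loads rise from `β` to `α`. In the
difference of the two optimal flows `i` is a sink and no load is a source, so a path along that
difference reaches `i` from a generator `k` that rises (`exists_source_conformal`). Shifting a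
little flow along this path moves each solution towards the other, so limits still hold, and on a
tree the new flows come from angles (`exists_exchange`). Optimality at `α` makes the shift costless
or better at `β`, contradicting uniqueness there. -/

theorem src_adj_tgt (P : PowerSystem nG nL nE) (e : Fin nE) :
    P.graph.Adj (P.src e) (P.tgt e) := by
  have h := (P.edge e).2
  rwa [P.edge_eq e, SimpleGraph.mem_edgeSet] at h

theorem incidence_apply (P : PowerSystem nG nL nE) (v : Bus nG nL) (e : Fin nE) :
    P.incidence v e =
      Pi.single (M := fun _ => ℝ) (P.src e) 1 v - Pi.single (M := fun _ => ℝ) (P.tgt e) 1 v := by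
  have hne := (P.src_adj_tgt e).ne
  simp only [incidence, Matrix.of_apply, Pi.single_apply]
  split_ifs <;> simp_all

theorem incidence_mulVec_single (P : PowerSystem nG nL nE) (e : Fin nE) :
    P.incidence.mulVec (Pi.single e 1) = Pi.single (P.src e) 1 - Pi.single (P.tgt e) 1 := by
  ext v
  simp [P.incidence_apply]

theorem flow_apply (P : PowerSystem nG nL nE) (θ : Bus nG nL → ℝ) (e : Fin nE) :
    P.flow θ e = P.b e * (θ (P.src e) - θ (P.tgt e)) := by
  rw [flow, ← Matrix.mulVec_mulVec, Matrix.mulVec_diagonal]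
  congr 1
  simp [Matrix.mulVec, dotProduct, P.incidence_apply, sub_mul, Finset.sum_sub_distrib,
    Pi.single_apply]

theorem laplacian_mulVec (P : PowerSystem nG nL nE) (θ : Bus nG nL → ℝ) :
    (P.incidence * Matrix.diagonal P.b * P.incidence.transpose).mulVec θ
      = P.incidence.mulVec (P.flow θ) := by
  rw [flow, Matrix.mulVec_mulVec, Matrix.mul_assoc]

/-- Angles that induce no flow are constant, because the network is connected. -/
theorem eq_of_flow_eq_zero (P : PowerSystem nG nL nE) {θ : Bus nG nL → ℝ} (h : P.flow θ = 0)
    (u v : Bus nG nL) : θ u = θ v := by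
  have hadj : ∀ u v, P.graph.Adj u v → θ u = θ v := by
    intro u v huv
    obtain ⟨e, he⟩ := P.edge.surjective ⟨s(u, v), huv⟩
    have hs : θ (P.src e) = θ (P.tgt e) := by
      have h0 := congrFun h e
      rw [flow_apply, Pi.zero_apply, mul_eq_zero, or_iff_right (P.b_pos e).ne'] at h0
      exact sub_eq_zero.1 h0
    have hp := P.edge_eq e
    rw [he] at hp
    rcases Sym2.eq_iff.1 hp with ⟨rfl, rfl⟩ | ⟨rfl, rfl⟩
    · exact hs
    · exact hs.symm
  obtain ⟨w⟩ := P.connected.preconnected u v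
  induction w with
  | nil => rfl
  | cons huv _ ih => exact (hadj _ _ huv).trans ih

/-- On a tree every branch flow vector is induced by voltage angles. -/
theorem exists_flow_eq_of_isTree [NeZero nG] (P : PowerSystem nG nL nE) (hT : P.graph.IsTree)
    (y : Fin nE → ℝ) : ∃ θ, θ (Sum.inl 0) = 0 ∧ P.flow θ = y := by
  classical
  -- Connectivity makes `L` injective; a tree has one more vertex than edges, so the dimensions
  -- agree and `L` is onto.
  let L : (Bus nG nL → ℝ) →ₗ[ℝ] ℝ × (Fin nE → ℝ) :=
    (LinearMap.proj (Sum.inl 0)).prod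
      (Matrix.mulVecLin (Matrix.diagonal P.b * P.incidence.transpose))
  have hL : ∀ θ, L θ = (θ (Sum.inl 0), P.flow θ) := fun _ => rfl
  have hinj : Function.Injective L := by
    rw [injective_iff_map_eq_zero]
    intro θ hθ
    rw [hL, Prod.mk_eq_zero] at hθ
    ext v
    rw [P.eq_of_flow_eq_zero hθ.2 v (Sum.inl 0), hθ.1, Pi.zero_apply]
  have hcard : nE + 1 = nG + nL := by
    have h := hT.card_edgeFinset
    rw [SimpleGraph.edgeFinset, Set.toFinset_card, ← Fintype.card_congr P.edge] at h
    simpa using h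
  have hdim : Module.finrank ℝ (Bus nG nL → ℝ) = Module.finrank ℝ (ℝ × (Fin nE → ℝ)) := by
    simp
    omega
  obtain ⟨θ, hθ⟩ := (LinearMap.injective_iff_surjective_of_finrank_eq_finrank hdim).1 hinj (0, y)
  rw [hL, Prod.mk.injEq] at hθ
  exact ⟨θ, hθ⟩

/-- Eliminates the angles: a tree has no cycles to constrain the flows. -/
theorem exists_feasible_of_isTree [NeZero nG] (P : PowerSystem nG nL nE) (hT : P.graph.IsTree)
    {sl : Fin nL → ℝ} {sg : Fin nG → ℝ} {y : Fin nE → ℝ}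
    (hbal : P.incidence.mulVec y = Sum.elim sg (-sl))
    (hsg : ∀ i, P.sgLo i ≤ sg i ∧ sg i ≤ P.sgHi i) (hy : ∀ e, P.pLo e ≤ y e ∧ y e ≤ P.pHi e) :
    ∃ θ, P.Feasible sl sg θ := by
  obtain ⟨θ, h0, rfl⟩ := P.exists_flow_eq_of_isTree hT y
  exact ⟨θ, h0, by rw [laplacian_mulVec, hbal], fun i => (hsg i).1, fun i => (hsg i).2,
    fun e => (hy e).1, fun e => (hy e).2⟩

/-- The vector `d` carries a positive flow from `u` to `v` on some branch. -/
def CarriesFlow (P : PowerSystem nG nL nE) (d : Fin nE → ℝ) (u v : Bus nG nL) : Prop :=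
  ∃ e, (P.src e = u ∧ P.tgt e = v ∧ 0 < d e) ∨ (P.tgt e = u ∧ P.src e = v ∧ d e < 0)

/-- A directed walk in the support of `d` carries a unit flow conformal to `d`. -/
theorem exists_conformal_of_reflTransGen (P : PowerSystem nG nL nE) {d : Fin nE → ℝ}
    {u v : Bus nG nL} (h : Relation.ReflTransGen (P.CarriesFlow d) u v) :
    ∃ c : Fin nE → ℝ, 0 ≤ c ∧
      P.incidence.mulVec (c * d) = Pi.single u 1 - Pi.single v 1 := by
  induction h using Relation.ReflTransGen.head_induction_on with
  | refl => exact ⟨0, le_rfl, by simp⟩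
  | @head u w huw _ ih =>
    obtain ⟨c, hc, hcd⟩ := ih
    obtain ⟨e, he⟩ := huw
    refine ⟨c + Pi.single e |d e|⁻¹, add_nonneg hc (Pi.single_nonneg.2 (by positivity)), ?_⟩
    rw [add_mul, Matrix.mulVec_add, hcd]
    rcases he with ⟨rfl, rfl, hd⟩ | ⟨rfl, rfl, hd⟩
    · have : Pi.single e |d e|⁻¹ * d = Pi.single e 1 := by
        rw [← Pi.single_mul_left, abs_of_pos hd, inv_mul_cancel₀ hd.ne']
      rw [this, incidence_mulVec_single]
      abel
    · have : Pi.single e |d e|⁻¹ * d = -Pi.single e 1 := by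
        rw [← Pi.single_mul_left, abs_of_neg hd, inv_neg, neg_mul, inv_mul_cancel₀ hd.ne,
          Pi.single_neg]
      rw [this, Matrix.mulVec_neg, incidence_mulVec_single]
      abel

/-- Every sink of a flow is reached from some source by a flow conformal to it. -/
theorem exists_source_conformal (P : PowerSystem nG nL nE) {d : Fin nE → ℝ} {v : Bus nG nL}
    (hv : P.incidence.mulVec d v < 0) :
    ∃ u, 0 < P.incidence.mulVec d u ∧ ∃ c : Fin nE → ℝ, 0 ≤ c ∧
      P.incidence.mulVec (c * d) = Pi.single u 1 - Pi.single v 1 := by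
  classical
  -- No flow enters `R` from outside, so its net outflow is nonnegative; the sink `v` must be offset
  -- by a source in `R`.
  let R : Finset (Bus nG nL) := {u | Relation.ReflTransGen (P.CarriesFlow d) u v}
  have hR : ∀ u, u ∈ R ↔ Relation.ReflTransGen (P.CarriesFlow d) u v := by simp [R]
  have hvR : v ∈ R := (hR v).2 .refl
  have hclosed : ∀ u w, P.CarriesFlow d u w → w ∈ R → u ∈ R := fun u w huw hw =>
    (hR u).2 (.head huw ((hR w).1 hw))
  have hsum : 0 ≤ ∑ u ∈ R, P.incidence.mulVec d u := by
    simp only [Matrix.mulVec, dotProduct]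
    rw [Finset.sum_comm]
    refine Finset.sum_nonneg fun e _ => ?_
    rw [← Finset.sum_mul]
    simp only [P.incidence_apply, Finset.sum_sub_distrib, Pi.single_apply, Finset.sum_ite_eq']
    rcases lt_trichotomy (d e) 0 with hd | hd | hd
    · have := hclosed _ _ ⟨e, .inr ⟨rfl, rfl, hd⟩⟩
      refine mul_nonneg_of_nonpos_of_nonpos ?_ hd.le
      split_ifs <;> simp_all
    · simp [hd]
    · have := hclosed _ _ ⟨e, .inl ⟨rfl, rfl, hd⟩⟩
      refine mul_nonneg ?_ hd.le
      split_ifs <;> simp_all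
  obtain ⟨u, huR, hu⟩ : ∃ u ∈ R, 0 < P.incidence.mulVec d u := by
    by_contra! hcon
    exact (Finset.sum_neg' hcon ⟨v, hvR, hv⟩).not_ge hsum
  exact ⟨u, hu, P.exists_conformal_of_reflTransGen ((hR u).1 huR)⟩

/-- If one generation decreases while no load decreases, then some generation `k` increases and a
small amount of generation can be exchanged between the two generators for both load vectors. -/
theorem exists_exchange [NeZero nG] (P : PowerSystem nG nL nE) (hT : P.graph.IsTree)
    {a b : Fin nL → ℝ} (hab : b ≤ a) {x x' : Fin nG → ℝ} {θ θ' : Bus nG nL → ℝ}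
    (hx : P.Feasible b x θ) (hx' : P.Feasible a x' θ') {i : Fin nG} (hi : x' i < x i) :
    ∃ z : Fin nG → ℝ, z ≠ 0 ∧ (∃ η, P.Feasible b (x + z) η) ∧ ∃ η, P.Feasible a (x' - z) η := by
  have hy : P.incidence.mulVec (P.flow θ) = Sum.elim x (-b) := by
    rw [← laplacian_mulVec, hx.balance]
  have hy' : P.incidence.mulVec (P.flow θ') = Sum.elim x' (-a) := by
    rw [← laplacian_mulVec, hx'.balance]
  set d := P.flow θ' - P.flow θ with hd
  have hCd : P.incidence.mulVec d = Sum.elim (x' - x) (-a + b) := by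
    rw [hd, Matrix.mulVec_sub, hy, hy']
    ext (j | j) <;> simp
  obtain ⟨u, hu, c, hc, hcd⟩ := P.exists_source_conformal (d := d) (v := Sum.inl i)
    (by rw [hCd]; simpa using hi)
  rw [hCd] at hu
  obtain ⟨k, rfl⟩ : ∃ k, u = Sum.inl k := by
    rcases u with k | j
    · exact ⟨k, rfl⟩
    · have := hab j
      simp at hu
      linarith
  have hk : x k < x' k := by simpa using hu
  have hki : k ≠ i := by rintro rfl; exact hk.not_gt hi
  -- These bounds keep every exchanged generation and flow between its two old values; the `1 +`
  -- covers `c = 0`.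
  obtain ⟨ε, hε, hεk, hεi, hεc⟩ : ∃ ε : ℝ, 0 < ε ∧ ε ≤ x' k - x k ∧ ε ≤ x i - x' i ∧
      ∀ e, ε * c e ≤ 1 := by
    have hS : 0 ≤ ∑ e, c e := Finset.sum_nonneg fun e _ => hc e
    refine ⟨min (min (x' k - x k) (x i - x' i)) (1 + ∑ e, c e)⁻¹, ?_,
      (min_le_left _ _).trans (min_le_left _ _), (min_le_left _ _).trans (min_le_right _ _), ?_⟩
    · exact lt_min (lt_min (sub_pos.2 hk) (sub_pos.2 hi)) (by positivity)
    · intro e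
      have he : c e ≤ ∑ e, c e := Finset.single_le_sum (fun e _ => hc e) (Finset.mem_univ e)
      calc _ ≤ (1 + ∑ e, c e)⁻¹ * (1 + ∑ e, c e) :=
            mul_le_mul (min_le_right _ _) (by linarith) (hc e) (by positivity)
        _ = 1 := inv_mul_cancel₀ (by positivity)
  let z : Fin nG → ℝ := ε • (Pi.single k 1 - Pi.single i 1)
  have hCz : P.incidence.mulVec (ε • (c * d)) = Sum.elim z 0 := by
    rw [Matrix.mulVec_smul, hcd]
    ext (j | j) <;> simp [z, Pi.single_apply]
  have hz : ∀ j, (x j ≤ x j + z j ∧ x j + z j ≤ x' j ∧ x j ≤ x' j - z j ∧ x' j - z j ≤ x' j) ∨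
      (x' j ≤ x j + z j ∧ x j + z j ≤ x j ∧ x' j ≤ x' j - z j ∧ x' j - z j ≤ x j) ∨ z j = 0 := by
    intro j
    rcases eq_or_ne j k with rfl | hjk
    · left
      have : z j = ε := by simp [z, hki]
      rw [this]
      refine ⟨?_, ?_, ?_, ?_⟩ <;> linarith
    · rcases eq_or_ne j i with rfl | hji
      · right; left
        have : z j = -ε := by simp [z, hjk]
        rw [this]
        refine ⟨?_, ?_, ?_, ?_⟩ <;> linarith
      · right; right
        simp [z, hjk, hji]
  have hflow : ∀ e, P.flow θ e + ε * (c e * d e) ∈ Set.Icc (P.pLo e) (P.pHi e) ∧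
      P.flow θ' e - ε * (c e * d e) ∈ Set.Icc (P.pLo e) (P.pHi e) := by
    intro e
    have h1 : P.flow θ e ∈ Set.Icc (P.pLo e) (P.pHi e) := ⟨hx.flow_lower e, hx.flow_upper e⟩
    have h2 : P.flow θ' e ∈ Set.Icc (P.pLo e) (P.pHi e) := ⟨hx'.flow_lower e, hx'.flow_upper e⟩
    have hconv := convex_Icc (𝕜 := ℝ) (P.pLo e) (P.pHi e)
    have ht : 0 ≤ ε * c e := mul_nonneg hε.le (hc e)
    constructor
    -- Convex combination of the old flows with weights `1 - ε * c e` and `ε * c e`.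
    · convert hconv h1 h2 (sub_nonneg.2 (hεc e)) ht (by ring) using 1
      simp [hd]
      ring
    · convert hconv h1 h2 ht (sub_nonneg.2 (hεc e)) (by ring) using 1
      simp [hd]
      ring
  refine ⟨z, ?_, ?_, ?_⟩
  · intro h0
    have := congrFun h0 k
    simp [z, hki] at this
    exact hε.ne' this
  · refine P.exists_feasible_of_isTree hT (y := P.flow θ + ε • (c * d)) ?_ ?_
      fun e => (hflow e).1
    · rw [Matrix.mulVec_add, hy, hCz]
      ext (j | j) <;> simp
    · intro j
      have := hx.gen_lower j
      have := hx.gen_upper j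
      have := hx'.gen_lower j
      have := hx'.gen_upper j
      rw [Pi.add_apply]
      rcases hz j with h | h | h <;> constructor <;> linarith
  · refine P.exists_feasible_of_isTree hT (y := P.flow θ' - ε • (c * d)) ?_ ?_
      fun e => (hflow e).2
    · rw [Matrix.mulVec_sub, hy', hCz]
      ext (j | j) <;> simp
    · intro j
      have := hx.gen_lower j
      have := hx.gen_upper j
      have := hx'.gen_lower j
      have := hx'.gen_upper j
      rw [Pi.sub_apply]
      rcases hz j with h | h | h <;> constructor <;> linarith

theorem opf_mem_opfSet [NeZero nG] (P : PowerSystem nG nL nE) (hP : P.HasUniqueOptimum)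
    (sl : P.loadRegion) : P.opf hP sl ∈ P.opfSet sl.1 :=
  (hP sl.1 sl.2).choose_spec.1

end PowerSystem

theorem mainTheorem3 {nG nL nE : ℕ} [NeZero nG] (P : PowerSystem nG nL nE)
    (hP : P.HasUniqueOptimum) (hTree : P.graph.IsTree) : P.IsMonotone hP := by
  intro α β hle _ i
  by_contra! hi
  have hβ := P.opf_mem_opfSet hP β
  obtain ⟨θ, hθ⟩ := id hβ
  obtain ⟨θ', hθ'⟩ := P.opf_mem_opfSet hP α
  obtain ⟨z, hz, ⟨η, hη⟩, η', hη'⟩ := P.exists_exchange hTree hle hθ.1 hθ'.1 hi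
  -- Undoing `z` at `α` cannot lower the cost.
  have hcost : P.cost ⬝ᵥ z ≤ 0 := by
    have := hθ'.2 _ _ hη'
    rw [dotProduct_sub] at this
    linarith
  have hopt : P.opf hP β + z ∈ P.opfSet β.1 := by
    refine ⟨η, hη, fun sg' η₁ h₁ => ?_⟩
    have := hθ.2 _ _ h₁
    rw [dotProduct_add]
    linarith
  exact hz (by simpa using (hP β.1 β.2).unique hopt hβ)
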